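/- **Definitions.** Let $\Gamma$ be a group. A *local embedding* of a subset $F\subseteq\Gamma$ into a group $Q$ is an injective map $\pi:F\to Q$ such that $\pi(gh)=\pi(g)\pi(h)$ whenever $g,h,gh\in F$. The group $\Gamma$ is *LEF* if every finite subset of $\Gamma$ admits a local embedding into some finite group. If $\Gamma$ is generated by a finite set $S$, let $B_S(n)$ be the set of products of at most $n$ elements of $S\cup S^{-1}$, and let the *LEF growth* $\mathcal{L}_\Gamma^S(n)$ be the least order of a finite group $Q$ for which there is a local embedding $B_S(n)\to Q$ (and $\infty$ if there is no such $Q$). Extend $\mathcal{L}_\Gamma^S$ to real $x>0$ by $\mathcal{L}_\Gamma^S(x)=\mathcal{L}_\Gamma^S(\lceil x\rceil)$. For nondecreasing functions $f_1,f_2:[1,\infty)\to(0,\infty]$ write $f_1\preceq f_2$ if there is a constant $K\ge 1$ such that $f_1(x)\le f_2(Kx)$ for all $x\ge 1$, and write $f_1\approx f_2$ if $f_1\preceq f_2$ and $f_2\preceq f_1$. **Statement.** For every $\alpha>1$ and $\beta\in(0,1)$ there exist constants $C,c>0$ and finitely generated LEF groups $\Gamma_1,\Gamma_2,\Gamma_3$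 such that, for all finite generating sets $S_1,S_2,S_3$ of $\Gamma_1,\Gamma_2,\Gamma_3$ respectively: 1. $\mathcal{L}_{\Gamma_1}^{S_1}(x)\approx\exp(x^{\alpha})$; 2. $\exp\big(c\exp((\log x)^{\alpha})\big)\preceq\mathcal{L}_{\Gamma_2}^{S_2}(x)\preceq\exp\big(C\exp((\log x)^{\alpha})\big)$; 3. $\exp\big(c\exp(x^{\beta})\big)\preceq\mathcal{L}_{\Gamma_3}^{S_3}(x)\preceq\exp\big(C\exp(x^{\beta})\big)$. -/

import Mathlib

open scoped ENNReal

namespace LEFGrowth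

/-- `π` restricts to a local embedding of `F ⊆ Γ` into `Δ`: an injective map on `F` which is
multiplicative whenever `g`, `h` and `g * h` all lie in `F`. Only the values of `π` on `F` matter. -/
structure IsLocalEmbedding {Γ Δ : Type*} [Group Γ] [Group Δ] (F : Set Γ) (π : Γ → Δ) : Prop where
  map_mul : ∀ g ∈ F, ∀ h ∈ F, g * h ∈ F → π (g * h) = π g * π h
  injOn : Set.InjOn π F

/-- `Γ` is locally embeddable into finite groups. -/
def IsLEF (Γ : Type*) [Group Γ] : Prop :=
  ∀ F : Set Γ, F.Finite →
    ∃ (Q : Type) (_ : Group Q), Finite Q ∧ ∃ π : Γ → Q, IsLocalEmbedding F π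

/-- The closed ball of radius `n` around `1` in the word metric of `S`: the products of at most
`n` elements of `S ∪ S⁻¹`. -/
def wordBall {Γ : Type*} [Group Γ] (S : Set Γ) (n : ℕ) : Set Γ :=
  {g | ∃ l : List Γ, l.length ≤ n ∧ (∀ x ∈ l, x ∈ S ∨ x⁻¹ ∈ S) ∧ l.prod = g}

/-- The LEF growth of `Γ` with respect to `S`: the least order of a finite group into which the
ball of radius `n` locally embeds (and `⊤` if there is none). -/
noncomputable def lefGrowth {Γ : Type*} [Group Γ] (S : Set Γ) (n : ℕ) : ℕ∞ :=
  sInf {q : ℕ∞ | ∃ (Q : Type) (_ : Group Q), Finite Q ∧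
    (∃ π : Γ → Q, IsLocalEmbedding (wordBall S n) π) ∧ q = (Nat.card Q : ℕ∞)}

/-- The LEF growth as a function of a positive real variable, constant on each `(n, n + 1]`. -/
noncomputable def lefGrowthReal {Γ : Type*} [Group Γ] (S : Set Γ) (x : ℝ) : ℝ≥0∞ :=
  (lefGrowth S ⌈x⌉₊ : ℝ≥0∞)

/-- `f ≼ g`: `f x ≤ g (C x)` for all `x ≥ 1`, for some constant `C ≥ 1`. -/
def Preceq (f g : ℝ → ℝ≥0∞) : Prop :=
  ∃ C : ℝ, 1 ≤ C ∧ ∀ x : ℝ, 1 ≤ x → f x ≤ g (C * x)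

/-- `f ≈ g`: `f ≼ g` and `g ≼ f`. -/
def GrowthEquiv (f g : ℝ → ℝ≥0∞) : Prop :=
  Preceq f g ∧ Preceq g f

end LEFGrowth

/-! Each group sits diagonally in a product of finite symmetric groups. Factor `k` permutes a
lamplighter space, a cycle of length `16 * 2 ^ k` carrying `m k + 1` lamps, together with two spare
points. Each mark swaps its spare point with one of two antipodal positions, all lamps off.

Upper bound: a word of length at most `2 ^ k` sees only local pictures: a line through one mark, a
lamplighter away from the marks, or a mark disabled by a lit lamp. Factor `k` already detects
whether the word is trivial in all of them, so the word is then trivial in every later factor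
(`wordPerm_eq_one_of_le`), and small balls embed in the product of the factors up to `k`.

Lower bound: shifting one mark by half of the `k`-th cycle makes the marks meet in factor `k` only,
so their commutator is a 3-cycle living there (`exists_markCycle_zero`). Conjugating by words of
length `O(2 ^ k)` gives one 3-cycle for each of the `N = lampCard m k` points. A finite group
receiving the ball must induce every even permutation of these elements by conjugation, so its order
is at least `N! / 2` (`factorial_le_of_isLocalEmbedding`).

The growth at scale `2 ^ k` is thus governed by `N!` with `N = 2 ^ (k + 5 + m k)`, and `m k < 2 ^ k`
is free. Tuning it realises any regular exponent between `x log x` and `2 ^ x`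
(`exists_growthEquiv`); the three families lie in this range. -/

namespace LEFGrowth

/-! ### Word balls, LEF growth and independence of the generating set. -/

section General

theorem IsLocalEmbedding.mono {Γ Δ : Type*} [Group Γ] [Group Δ] {F F' : Set Γ} {π : Γ → Δ}
    (h : IsLocalEmbedding F π) (hF : F' ⊆ F) : IsLocalEmbedding F' π :=
  ⟨fun g hg k hk hgk => h.map_mul g (hF hg) k (hF hk) (hF hgk), h.injOn.mono hF⟩

variable {Γ : Type*} [Group Γ]

theorem wordBall_mono (S : Set Γ) {m n : ℕ} (h : m ≤ n) : wordBall S m ⊆ wordBall S n := by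
  rintro g ⟨l, hl, hS, rfl⟩
  exact ⟨l, hl.trans h, hS, rfl⟩

theorem one_mem_wordBall (S : Set Γ) (n : ℕ) : (1 : Γ) ∈ wordBall S n :=
  ⟨[], by simp, by simp, rfl⟩

theorem mem_wordBall_of_mem {S : Set Γ} {g : Γ} (h : g ∈ S) : g ∈ wordBall S 1 :=
  ⟨[g], by simp, by simp [h], by simp⟩

theorem mul_mem_wordBall {S : Set Γ} {m n : ℕ} {g h : Γ} (hg : g ∈ wordBall S m)
    (hh : h ∈ wordBall S n) : g * h ∈ wordBall S (m + n) := by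
  obtain ⟨l, hl, hS, rfl⟩ := hg
  obtain ⟨l', hl', hS', rfl⟩ := hh
  refine ⟨l ++ l', by simp; omega, ?_, by simp⟩
  intro x hx
  rcases List.mem_append.1 hx with h | h
  exacts [hS x h, hS' x h]

theorem inv_mem_wordBall {S : Set Γ} {n : ℕ} {g : Γ} (hg : g ∈ wordBall S n) :
    g⁻¹ ∈ wordBall S n := by
  obtain ⟨l, hl, hS, rfl⟩ := hg
  refine ⟨(l.map (·⁻¹)).reverse, by simpa using hl, ?_, (List.prod_inv_reverse l).symm⟩
  intro x hx
  simp only [List.mem_reverse, List.mem_map] at hx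
  obtain ⟨y, hy, rfl⟩ := hx
  simpa [or_comm] using hS y hy

theorem pow_mem_wordBall {S : Set Γ} {m : ℕ} {g : Γ} (hg : g ∈ wordBall S m) (n : ℕ) :
    g ^ n ∈ wordBall S (m * n) := by
  induction n with
  | zero => simpa using one_mem_wordBall S 0
  | succ n ih => rw [pow_succ, mul_add, mul_one]; exact mul_mem_wordBall ih hg

theorem exists_mem_wordBall {S : Set Γ} (hS : Subgroup.closure S = ⊤) (g : Γ) :
    ∃ n, g ∈ wordBall S n := by
  have hg : g ∈ Subgroup.closure S := hS ▸ Subgroup.mem_top g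
  induction hg using Subgroup.closure_induction with
  | mem x hx => exact ⟨1, mem_wordBall_of_mem hx⟩
  | one => exact ⟨0, one_mem_wordBall S 0⟩
  | mul x y _ _ hx hy =>
    obtain ⟨m, hm⟩ := hx
    obtain ⟨n, hn⟩ := hy
    exact ⟨_, mul_mem_wordBall hm hn⟩
  | inv x _ hx => exact hx.imp fun _ h => inv_mem_wordBall h

theorem exists_subset_wordBall {S F : Set Γ} (hS : Subgroup.closure S = ⊤) (hF : F.Finite) :
    ∃ n, F ⊆ wordBall S n := by
  induction F, hF using Set.Finite.induction_on with
  | empty => exact ⟨0, by simp⟩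
  | @insert a s _ _ ih =>
    obtain ⟨n, hn⟩ := ih
    obtain ⟨m, hm⟩ := exists_mem_wordBall hS a
    refine ⟨max m n, Set.insert_subset (wordBall_mono S (le_max_left _ _) hm)
      (hn.trans (wordBall_mono S (le_max_right _ _)))⟩

theorem exists_wordBall_subset {S T : Set Γ} (hS : S.Finite) (hT : Subgroup.closure T = ⊤) :
    ∃ K : ℕ, 1 ≤ K ∧ ∀ n, wordBall S n ⊆ wordBall T (K * n) := by
  obtain ⟨K, hK⟩ := exists_subset_wordBall hT hS
  refine ⟨K + 1, by omega, ?_⟩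
  rintro n g ⟨l, hl, hlS, rfl⟩
  refine wordBall_mono T (Nat.mul_le_mul_left (K + 1) hl) ?_
  clear hl
  induction l with
  | nil => exact one_mem_wordBall _ _
  | cons x l ih =>
    rw [List.prod_cons, List.length_cons, mul_add, mul_one, add_comm]
    refine mul_mem_wordBall ?_ (ih fun y hy => hlS y (by simp [hy]))
    refine wordBall_mono T (Nat.le_succ K) ?_
    rcases hlS x (by simp) with h | h
    · exact hK h
    · simpa using inv_mem_wordBall (hK h)

theorem lefGrowth_le_of_subset {S T : Set Γ} {m n : ℕ} (h : wordBall S m ⊆ wordBall T n) :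
    lefGrowth S m ≤ lefGrowth T n := by
  refine sInf_le_sInf ?_
  rintro q ⟨Q, iQ, hQ, ⟨π, hπ⟩, rfl⟩
  exact ⟨Q, iQ, hQ, ⟨π, hπ.mono h⟩, rfl⟩

theorem lefGrowth_mono (S : Set Γ) {m n : ℕ} (h : m ≤ n) : lefGrowth S m ≤ lefGrowth S n :=
  lefGrowth_le_of_subset (wordBall_mono S h)

theorem lefGrowth_le_natCard {S : Set Γ} {n : ℕ} {Q : Type} [Group Q] [Finite Q] {π : Γ → Q}
    (hπ : IsLocalEmbedding (wordBall S n) π) : lefGrowth S n ≤ Nat.card Q :=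
  sInf_le ⟨Q, inferInstance, inferInstance, ⟨π, hπ⟩, rfl⟩

theorem isLEF_of_wordBall {S : Set Γ} (hS : Subgroup.closure S = ⊤)
    (h : ∀ n, ∃ (Q : Type) (_ : Group Q), Finite Q ∧ ∃ π : Γ → Q,
      IsLocalEmbedding (wordBall S n) π) : IsLEF Γ := by
  intro F hF
  obtain ⟨n, hn⟩ := exists_subset_wordBall hS hF
  obtain ⟨Q, iQ, hQ, π, hπ⟩ := h n
  exact ⟨Q, iQ, hQ, π, hπ.mono hn⟩

theorem Preceq.trans {f g h : ℝ → ℝ≥0∞} (hfg : Preceq f g) (hgh : Preceq g h) : Preceq f h := by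
  obtain ⟨C, hC, h₁⟩ := hfg
  obtain ⟨D, hD, h₂⟩ := hgh
  refine ⟨D * C, one_le_mul_of_one_le_of_one_le hD hC, fun x hx => (h₁ x hx).trans ?_⟩
  rw [mul_assoc]
  exact h₂ _ (one_le_mul_of_one_le_of_one_le hC hx)

theorem preceq_lefGrowthReal {S T : Set Γ} (hS : S.Finite) (hT : Subgroup.closure T = ⊤) :
    Preceq (lefGrowthReal S) (lefGrowthReal T) := by
  obtain ⟨K, hK, h⟩ := exists_wordBall_subset hS hT
  have hK' : (1 : ℝ) ≤ K := by exact_mod_cast hK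
  -- The factor 2 absorbs the ceiling: `⌈x⌉ < x + 1 ≤ 2 * x`.
  refine ⟨2 * K, by linarith, fun x hx => ?_⟩
  have : K * ⌈x⌉₊ ≤ ⌈2 * K * x⌉₊ := by
    have h1 : (⌈x⌉₊ : ℝ) < x + 1 := Nat.ceil_lt_add_one (by linarith)
    have h2 : (2 * K * x : ℝ) ≤ ⌈2 * K * x⌉₊ := Nat.le_ceil _
    have : ((K * ⌈x⌉₊ : ℕ) : ℝ) ≤ ⌈2 * K * x⌉₊ := by
      push_cast
      nlinarith
    exact_mod_cast this
  have h3 := (lefGrowth_le_of_subset (h ⌈x⌉₊)).trans (lefGrowth_mono T this)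
  unfold lefGrowthReal
  exact_mod_cast h3

/-- Growth equivalence need only be checked on one finite generating set. -/
theorem growthEquiv_of_generating {S T : Set Γ} {f : ℝ → ℝ≥0∞} (hS : S.Finite)
    (hS' : Subgroup.closure S = ⊤) (hT : T.Finite) (hT' : Subgroup.closure T = ⊤)
    (h : GrowthEquiv (lefGrowthReal S) f) : GrowthEquiv (lefGrowthReal T) f :=
  ⟨(preceq_lefGrowthReal hT hS').trans h.1, h.2.trans (preceq_lefGrowthReal hS hT')⟩

end General

/-! ### Lamplighter spaces and their local pictures. -/

section Model

/-- The lamp configurations on `m + 1` sites of a cycle of length `16 * l`, together with the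
position of a lamplighter on that cycle, and two additional points. -/
abbrev LampSpace (l m : ℕ) : Type := (ZMod (16 * l) × (Fin (m + 1) → ZMod 2)) ⊕ Bool

inductive Letter : Type
  | shift
  | unshift
  | toggle
  | mark (b : Bool)

/-- The positions of the two marks on the cycle. -/
def center (l : ℕ) : Bool → ℤ
  | true => 8 * l
  | false => 0

/-- The position of the mark `b` with all lamps off. -/
def basePoint (l m : ℕ) (b : Bool) : LampSpace l m := Sum.inl ((center l b : ZMod (16 * l)), 0)

def shiftPerm (l m : ℕ) : Equiv.Perm (LampSpace l m) :=
  Equiv.sumCongr (Equiv.prodCongr (Equiv.addRight 1) (Equiv.refl _)) (Equiv.refl _)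

def toggleFun (l m : ℕ) (x : ZMod (16 * l) × (Fin (m + 1) → ZMod 2)) :
    ZMod (16 * l) × (Fin (m + 1) → ZMod 2) :=
  (x.1, fun i => if x.1 = ((4 * l + i : ℤ) : ZMod (16 * l)) then x.2 i + 1 else x.2 i)

theorem toggleFun_involutive (l m : ℕ) : Function.Involutive (toggleFun l m) := by
  rintro ⟨p, c⟩
  have h2 : (1 : ZMod 2) + 1 = 0 := by decide
  refine Prod.ext rfl (funext fun i => ?_)
  by_cases h : p = ((4 * l + i : ℤ) : ZMod (16 * l))
  · simp only [toggleFun, if_pos h, add_assoc, h2, add_zero]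
  · simp only [toggleFun, if_neg h]

/-- The lamp at the current position is switched. -/
def togglePerm (l m : ℕ) : Equiv.Perm (LampSpace l m) :=
  Equiv.sumCongr (toggleFun_involutive l m).toPerm (Equiv.refl _)

def letterPerm (l m : ℕ) : Letter → Equiv.Perm (LampSpace l m)
  | .shift => shiftPerm l m
  | .unshift => (shiftPerm l m)⁻¹
  | .toggle => togglePerm l m
  | .mark b => Equiv.swap (basePoint l m b) (Sum.inr b)

def wordPerm (l m : ℕ) (w : List Letter) : Equiv.Perm (LampSpace l m) :=
  (w.map (letterPerm l m)).prod

@[simp] theorem letterPerm_shift_inl (l m : ℕ) (p c) :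
    letterPerm l m .shift (Sum.inl (p, c)) = Sum.inl (p + 1, c) := rfl

@[simp] theorem letterPerm_unshift_inl (l m : ℕ) (p c) :
    letterPerm l m .unshift (Sum.inl (p, c)) = Sum.inl (p - 1, c) := by
  change (shiftPerm l m)⁻¹ _ = _
  rw [Equiv.Perm.inv_eq_iff_eq]
  change _ = Sum.inl (p - 1 + 1, c)
  simp

@[simp] theorem letterPerm_toggle_inl (l m : ℕ) (x) :
    letterPerm l m .toggle (Sum.inl x) = Sum.inl (toggleFun l m x) := rfl

@[simp] theorem letterPerm_shift_inr (l m : ℕ) (b) :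
    letterPerm l m .shift (Sum.inr b) = Sum.inr b := rfl

@[simp] theorem letterPerm_unshift_inr (l m : ℕ) (b) :
    letterPerm l m .unshift (Sum.inr b) = Sum.inr b := by
  change (shiftPerm l m)⁻¹ _ = _
  rw [Equiv.Perm.inv_eq_iff_eq]
  rfl

@[simp] theorem letterPerm_toggle_inr (l m : ℕ) (b) :
    letterPerm l m .toggle (Sum.inr b) = Sum.inr b := rfl

theorem letterPerm_mark (l m : ℕ) (b) :
    letterPerm l m (.mark b) = Equiv.swap (basePoint l m b) (Sum.inr b) := rfl

theorem zmod_intCast_inj {N : ℕ} {a b : ℤ} (h₁ : a - b < N) (h₂ : b - a < N) :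
    (a : ZMod N) = b ↔ a = b := by
  refine ⟨fun h => ?_, fun h => by rw [h]⟩
  rw [ZMod.intCast_eq_intCast_iff_dvd_sub] at h
  have := Int.eq_zero_of_abs_lt_dvd h (by rw [abs_lt]; omega)
  omega

/-- A map from a set with a formal action of the letters that is equivariant along short
trajectories is equivariant for short words. -/
theorem wordPerm_transport {l m : ℕ} {A : Type*} (act : Letter → A → A) (φ : A → LampSpace l m)
    (B : ℕ → A → Prop) (r : ℕ)
    (step : ∀ n < r, ∀ a, B n a → ∀ s,
      letterPerm l m s (φ a) = φ (act s a) ∧ B (n + 1) (act s a))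
    (w : List Letter) (hw : w.length ≤ r) (a : A) (ha : B 0 a) :
    wordPerm l m w (φ a) = φ (w.foldr act a) ∧ B w.length (w.foldr act a) := by
  induction w with
  | nil => exact ⟨rfl, ha⟩
  | cons s w ih =>
    simp only [List.length_cons] at hw
    obtain ⟨h₁, h₂⟩ := ih (by omega)
    obtain ⟨h₃, h₄⟩ := step w.length (by omega) _ h₂ s
    refine ⟨?_, h₄⟩
    rw [List.foldr_cons, ← h₃, ← h₁]
    simp [wordPerm]

/-- The formal action of the letters in the neighbourhood of the mark `b`. -/
def markAct (b : Bool) : Letter → Option ℤ → Option ℤ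
  | .shift => Option.map (· + 1)
  | .unshift => Option.map (· - 1)
  | .toggle => id
  | .mark b' => if b' = b then Equiv.swap (some 0) none else id

def markChart (l m : ℕ) (b : Bool) : Option ℤ → LampSpace l m
  | none => Sum.inr b
  | some k => Sum.inl (((center l b + k : ℤ) : ZMod (16 * l)), 0)

theorem toggleFun_eq_self {l m : ℕ} {p : ℤ} {c : Fin (m + 1) → ZMod 2}
    (h : ∀ i : Fin (m + 1), (p : ZMod (16 * l)) ≠ ((4 * l + i : ℤ) : ZMod (16 * l))) :
    toggleFun l m ((p : ZMod (16 * l)), c) = ((p : ZMod (16 * l)), c) := by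
  simp only [toggleFun, h, if_false]

/-- The sites lie in `[4l, 5l)`, outside the windows of radius `2l` about `0` and `8l`, so toggles
are inert near the marks. -/
theorem near_center_ne_site {l m : ℕ} (hm : m < l) {b : Bool} {k : ℤ} (hk : |k| ≤ 2 * l)
    (i : Fin (m + 1)) :
    ((center l b + k : ℤ) : ZMod (16 * l)) ≠ ((4 * l + i : ℤ) : ZMod (16 * l)) := by
  have hi := i.2
  rw [abs_le] at hk
  cases b <;> simp only [center] <;>
  · rw [Ne, zmod_intCast_inj] <;> push_cast <;> omega

theorem near_center_eq {l : ℕ} (hl : 0 < l) {b b' : Bool} {k k' : ℤ} (hk : |k| ≤ 2 * l)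
    (hk' : |k'| ≤ 2 * l) :
    ((center l b + k : ℤ) : ZMod (16 * l)) = ((center l b' + k' : ℤ) : ZMod (16 * l)) ↔
      b = b' ∧ k = k' := by
  rw [abs_le] at hk hk'
  cases b <;> cases b' <;> simp only [center] <;>
  · rw [zmod_intCast_inj] <;> push_cast <;> simp <;> omega

theorem markChart_inj {l m : ℕ} (hl : 0 < l) {b : Bool} {x y : Option ℤ}
    (hx : ∀ k, x = some k → |k| ≤ 2 * l) (hy : ∀ k, y = some k → |k| ≤ 2 * l) :
    markChart l m b x = markChart l m b y ↔ x = y := by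
  refine ⟨fun h => ?_, fun h => by rw [h]⟩
  cases x with
  | none => cases y with
    | none => rfl
    | some k => simp [markChart] at h
  | some k => cases y with
    | none => simp [markChart] at h
    | some k' =>
      simp only [markChart, Sum.inl.injEq, Prod.mk.injEq, and_true] at h
      rw [((near_center_eq hl (hx k rfl) (hy k' rfl)).1 h).2]

/-- From distance at most `r`, `n` letters lead no further than `r + n ≤ 2l`: no site and no second
mark is met. -/
theorem markChart_step {l m : ℕ} (hm : m < l) {r : ℕ} (hr : r ≤ l) (b : Bool) (n : ℕ)
    (hn : n < r) (a : Option ℤ) (ha : ∀ k, a = some k → |k| ≤ r + n) (s : Letter) :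
    letterPerm l m s (markChart l m b a) = markChart l m b (markAct b s a) ∧
      ∀ k, markAct b s a = some k → |k| ≤ r + (n + 1 : ℕ) := by
  have hl : 0 < l := by omega
  have hb : ∀ k, a = some k → |k| ≤ 2 * (l : ℤ) := fun k hk => (ha k hk).trans (by omega)
  push_cast
  cases s with
  | shift => cases a with
    | none => simp [markChart, markAct]
    | some k =>
      refine ⟨by simp [markChart, markAct, add_assoc], fun j hj => ?_⟩
      have := abs_le.1 (ha k rfl)
      simp only [markAct, Option.map_some, Option.some.injEq] at hj
      rw [abs_le]; omega
  | unshift => cases a with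
    | none => simp [markChart, markAct]
    | some k =>
      refine ⟨by simp [markChart, markAct, add_sub_assoc], fun j hj => ?_⟩
      have := abs_le.1 (ha k rfl)
      simp only [markAct, Option.map_some, Option.some.injEq] at hj
      rw [abs_le]; omega
  | toggle =>
    refine ⟨?_, fun j hj => (ha j hj).trans (by omega)⟩
    cases a with
    | none => simp [markChart, markAct]
    | some k =>
      simp only [markChart, markAct, letterPerm_toggle_inl, id]
      rw [toggleFun_eq_self (near_center_ne_site hm (hb k rfl))]
  | mark b' =>
    have hbase : ∀ b, basePoint l m b = markChart l m b (some 0) := by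
      intro b; simp [basePoint, markChart]
    by_cases h : b' = b
    · subst h
      have h0 : ∀ k, some (0 : ℤ) = some k → |k| ≤ 2 * (l : ℤ) := by
        rintro k hk; cases hk; simp
      simp only [letterPerm_mark, markAct, if_true, hbase]
      rw [show (Sum.inr b' : LampSpace l m) = markChart l m b' none from rfl]
      constructor
      · simp only [Equiv.swap_apply_def, markChart_inj hl hb h0,
          markChart_inj hl hb (y := none) (by simp)]
        split_ifs <;> rfl
      · intro k hk
        rw [Equiv.swap_apply_def] at hk
        split_ifs at hk
        · cases hk; simp; omega
        · exact (ha k hk).trans (by omega)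
    · simp only [letterPerm_mark, markAct, if_neg h, id]
      refine ⟨?_, fun j hj => (ha j hj).trans (by omega)⟩
      apply Equiv.swap_apply_of_ne_of_ne
      · cases a with
        | none => simp [markChart, basePoint]
        | some k =>
          rw [hbase]
          simp only [markChart, ne_eq, Sum.inl.injEq, Prod.mk.injEq, and_true]
          rw [near_center_eq hl (hb k rfl) (by simp)]
          exact fun h' => h h'.1.symm
      · cases a with
        | none => simpa [markChart] using fun h' => h h'.symm
        | some k => simp [markChart]

/-- The formal action of the letters away from the marks. -/
def lampAct : Letter → ℤ × (ℤ → ZMod 2) → ℤ × (ℤ → ZMod 2)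
  | .shift => fun x => (x.1 + 1, x.2)
  | .unshift => fun x => (x.1 - 1, x.2)
  | .toggle => fun x => (x.1, Function.update x.2 x.1 (x.2 x.1 + 1))
  | .mark _ => id

def LampBound (n : ℕ) (x : ℤ × (ℤ → ZMod 2)) : Prop :=
  |x.1| ≤ n ∧ ∀ q : ℤ, (n : ℤ) < |q| → x.2 q = 0

theorem lampBound_step {n : ℕ} {x : ℤ × (ℤ → ZMod 2)} (h : LampBound n x) (s : Letter) :
    LampBound (n + 1) (lampAct s x) := by
  obtain ⟨h₁, h₂⟩ := h
  have h₃ := abs_le.1 h₁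
  have h₂' : ∀ q : ℤ, ((n + 1 : ℕ) : ℤ) < |q| → x.2 q = 0 := fun q hq => h₂ q (by push_cast at hq; omega)
  cases s with
  | shift => exact ⟨by simp only [lampAct]; rw [abs_le]; push_cast; omega, h₂'⟩
  | unshift => exact ⟨by simp only [lampAct]; rw [abs_le]; push_cast; omega, h₂'⟩
  | mark b => exact ⟨by simp only [lampAct, id]; rw [abs_le]; push_cast; omega, h₂'⟩
  | toggle =>
    refine ⟨by simp only [lampAct]; rw [abs_le]; push_cast; omega, fun q hq => ?_⟩
    have : q ≠ x.1 := by rintro rfl; push_cast at hq; omega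
    simp only [lampAct, Function.update_of_ne this]
    exact h₂' q hq

/-- `x` records the displacement from `p` and the lamps changed relative to `c`; changes at
positions without a site are forgotten. -/
def lampChart (l m : ℕ) (p : ℤ) (c : Fin (m + 1) → ZMod 2) (x : ℤ × (ℤ → ZMod 2)) :
    LampSpace l m :=
  Sum.inl (((p + x.1 : ℤ) : ZMod (16 * l)), fun i => c i + x.2 (4 * l + i - p))

theorem lampChart_step {l m : ℕ} (hm : m < l) {r : ℕ} {p : ℤ}
    (h₁ : (r : ℤ) < p) (h₂ : p + r < 16 * l) (h₃ : (r : ℤ) < |p - 8 * l|)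
    (c : Fin (m + 1) → ZMod 2) (n : ℕ) (hn : n < r) (x : ℤ × (ℤ → ZMod 2))
    (hx : LampBound n x) (s : Letter) :
    letterPerm l m s (lampChart l m p c x) = lampChart l m p c (lampAct s x) ∧
      LampBound (n + 1) (lampAct s x) := by
  refine ⟨?_, lampBound_step hx s⟩
  obtain ⟨k, E⟩ := x
  have hk := abs_le.1 hx.1
  simp only at hk
  cases s with
  | shift => simp [lampChart, lampAct, add_assoc]
  | unshift => simp [lampChart, lampAct, add_sub_assoc]
  | toggle =>
    simp only [lampChart, lampAct, letterPerm_toggle_inl, toggleFun, Sum.inl.injEq, Prod.mk.injEq,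
      true_and]
    funext i
    have hi := i.2
    have hiff : ((p + k : ℤ) : ZMod (16 * l)) = ((4 * l + i : ℤ) : ZMod (16 * l)) ↔
        p + k = 4 * l + i := zmod_intCast_inj (by push_cast; omega) (by push_cast; omega)
    rw [Function.update_apply]
    simp only [hiff]
    by_cases h : p + k = 4 * l + i
    · rw [if_pos h, if_pos (by omega), show (4 * l + i - p : ℤ) = k by omega, add_assoc]
    · rw [if_neg h, if_neg (by omega)]
  | mark b =>
    apply Equiv.swap_apply_of_ne_of_ne
    · simp only [lampChart, basePoint, ne_eq, Sum.inl.injEq, Prod.mk.injEq, not_and]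
      intro h
      exfalso
      revert h
      rw [lt_abs] at h₃
      cases b <;> simp only [center] <;>
      · rw [zmod_intCast_inj] <;> push_cast <;> omega
    · simp [lampChart]

/-- Marks act only where all lamps are off and no site is within reach, so only the shifts act and
`c` is frozen. -/
theorem frozenChart_step {l m : ℕ} (hm : m < l) {r : ℕ} (hr : r ≤ l) {b : Bool} {j : ℤ}
    (hj : |j| ≤ r) {c : Fin (m + 1) → ZMod 2} (hc : c ≠ 0) (n : ℕ) (hn : n < r)
    (x : ℤ × (ℤ → ZMod 2)) (hx : LampBound n x) (s : Letter) :
    letterPerm l m s (Sum.inl (((center l b + j + x.1 : ℤ) : ZMod (16 * l)), c)) =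
        Sum.inl (((center l b + j + (lampAct s x).1 : ℤ) : ZMod (16 * l)), c) ∧
      LampBound (n + 1) (lampAct s x) := by
  refine ⟨?_, lampBound_step hx s⟩
  obtain ⟨k, E⟩ := x
  have hk := abs_le.1 hx.1
  rw [abs_le] at hj
  simp only at hk
  cases s with
  | shift => simp [lampAct, add_assoc]
  | unshift => simp [lampAct, add_sub_assoc]
  | toggle =>
    have hjk : |j + k| ≤ 2 * (l : ℤ) := by rw [abs_le]; omega
    rw [letterPerm_toggle_inl, add_assoc, toggleFun_eq_self (near_center_ne_site hm hjk)]
    simp [lampAct, add_assoc]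
  | mark b' =>
    apply Equiv.swap_apply_of_ne_of_ne
    · simp [basePoint, hc]
    · simp

theorem foldr_markAct_of_wordPerm {l m : ℕ} (hm : m < l) {w : List Letter} (hw : w.length ≤ l)
    (h : wordPerm l m w = 1) (b : Bool) (a : Option ℤ) (ha : ∀ k, a = some k → |k| ≤ l) :
    w.foldr (markAct b) a = a := by
  obtain ⟨h₁, h₂⟩ := wordPerm_transport (markAct b) (markChart l m b)
    (fun n a => ∀ k, a = some k → |k| ≤ (l : ℤ) + n) l
    (fun n hn a ha s => markChart_step hm le_rfl b n hn a ha s) w hw a (by simpa using ha)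
  rw [h, Equiv.Perm.one_apply, markChart_inj (by omega)
    (fun k hk => (ha k hk).trans (by omega)) (fun k hk => (h₂ k hk).trans (by omega))] at h₁
  exact h₁.symm

/-- Starting at `4l - q` puts site `0` at displacement `q`. Varying the start thus reads off every
lamp a short word can change, even with a single site. -/
theorem foldr_lampAct_of_wordPerm {l m : ℕ} (hm : m < l) {w : List Letter} (hw : w.length ≤ l)
    (h : wordPerm l m w = 1) : w.foldr lampAct (0, 0) = (0, 0) := by
  have key : ∀ q : ℤ, |q| ≤ l →
      (w.foldr lampAct (0, 0)).1 = 0 ∧ (w.foldr lampAct (0, 0)).2 q = 0 ∧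
        ∀ q' : ℤ, (l : ℤ) < |q'| → (w.foldr lampAct (0, 0)).2 q' = 0 := by
    intro q hq
    rw [abs_le] at hq
    obtain ⟨h₁, h₂⟩ := wordPerm_transport lampAct (lampChart l m (4 * l - q) 0) LampBound l
      (lampChart_step hm (by omega) (by omega) (by rw [lt_abs]; omega) 0) w hw (0, 0)
      ⟨by simp, by simp⟩
    rw [h, Equiv.Perm.one_apply] at h₁
    simp only [lampChart, Sum.inl.injEq, Prod.mk.injEq] at h₁
    have h₃ := abs_le.1 h₂.1
    refine ⟨?_, ?_, fun q' hq' => h₂.2 q' (by omega)⟩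
    · have := (zmod_intCast_inj (by push_cast; omega) (by push_cast; omega)).1 h₁.1
      omega
    · have := congrFun h₁.2 0
      simpa using this.symm
  refine Prod.ext (key 0 (by simp)).1 (funext fun q => ?_)
  by_cases hq : |q| ≤ l
  · exact (key q hq).2.1
  · exact (key 0 (by simp)).2.2 q (by omega)

/-- A short word acting trivially on one of the spaces acts trivially on all larger ones. -/
theorem wordPerm_eq_one_of_le {l m l' m' : ℕ} (hm : m < l) (hm' : m' < l') (hl : l ≤ l')
    {w : List Letter} (hw : w.length ≤ l) (h : wordPerm l m w = 1) : wordPerm l' m' w = 1 := by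
  have hmark : ∀ (b : Bool) (a : Option ℤ), (∀ k, a = some k → |k| ≤ l) →
      wordPerm l' m' w (markChart l' m' b a) = markChart l' m' b a := by
    intro b a ha
    obtain ⟨h₁, -⟩ := wordPerm_transport (markAct b) (markChart l' m' b)
      (fun n a => ∀ k, a = some k → |k| ≤ (l : ℤ) + n) l
      (fun n hn a ha s => markChart_step hm' hl b n hn a ha s) w hw a (by simpa using ha)
    rw [h₁, foldr_markAct_of_wordPerm hm hw h b a ha]
  have hlamp := foldr_lampAct_of_wordPerm hm hw h
  have h0 : LampBound 0 (0, 0) := ⟨by simp, by simp⟩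
  refine Equiv.ext fun x => ?_
  rw [Equiv.Perm.one_apply]
  rcases x with ⟨p, c⟩ | b
  -- Near a mark the point lies in the mark chart or is frozen; otherwise the lamp chart applies.
  · by_cases hp : ∃ (b : Bool) (k : ℤ), |k| ≤ l ∧ p = ((center l' b + k : ℤ) : ZMod (16 * l'))
    · obtain ⟨b, k, hk, rfl⟩ := hp
      by_cases hc : c = 0
      · subst hc
        exact hmark b (some k) (by rintro j hj; cases hj; exact hk)
      · obtain ⟨h₁, -⟩ := wordPerm_transport lampAct _ LampBound l
          (frozenChart_step (b := b) hm' hl hk hc) w hw (0, 0) h0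
        simpa [hlamp] using h₁
    · have : NeZero (16 * l') := ⟨by omega⟩
      have hv := ZMod.val_lt p
      have hpv : ((p.val : ℤ) : ZMod (16 * l')) = p := by simp
      generalize p.val = v at hv hpv
      subst hpv
      have hfar : ∀ (b : Bool) (k : ℤ), (v : ZMod (16 * l')) = ((center l' b + k : ℤ) : ZMod (16 * l')) →
          (l : ℤ) < |k| := by
        intro b k hk
        by_contra h'
        exact hp ⟨b, k, not_lt.1 h', by simpa using hk⟩
      -- The mark at `0` has to be avoided at both ends of `[0, 16l')`.
      have f₁ := hfar false v (by simp [center])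
      have f₂ := hfar false (v - 16 * l') (by
        have : (16 * (l' : ZMod (16 * l'))) = 0 := by exact_mod_cast ZMod.natCast_self (16 * l')
        simp [center, this])
      have f₃ := hfar true (v - 8 * l') (by simp [center])
      obtain ⟨h₁, -⟩ := wordPerm_transport lampAct (lampChart l' m' v c) LampBound l
        (lampChart_step hm' (by rw [lt_abs] at f₁; omega) (by rw [lt_abs] at f₂; omega) f₃ c)
        w hw (0, 0) h0
      simpa [hlamp, lampChart] using h₁
  · exact hmark b none (by simp)

end Model

/-! ### Finite groups inducing all even permutations by conjugation. -/

section LowerBound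

open Equiv

/-- The `3`-cycle through `x` and the two additional points. -/
def markCycle {Y : Type*} [DecidableEq Y] (x : Y) : Perm (Y ⊕ Bool) :=
  swap (Sum.inl x) (Sum.inr true) * swap (Sum.inl x) (Sum.inr false)

/-- For swaps `A`, `B` sharing one point, `A * B` has order 3, so the commutator `(A * B) ^ 2` is
its inverse `B * A`. -/
theorem markCycle_eq_commutator {Y : Type*} [DecidableEq Y] (x : Y) :
    markCycle x = swap (Sum.inl x) (Sum.inr false) * swap (Sum.inl x) (Sum.inr true) *
      swap (Sum.inl x) (Sum.inr false) * swap (Sum.inl x) (Sum.inr true) := by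
  refine Equiv.ext fun v => ?_
  simp only [markCycle, Perm.mul_apply]
  rcases v with v | b
  · by_cases h : v = x
    · subst h; simp [swap_apply_def]
    · simp [swap_apply_def, h]
  · cases b <;> simp [swap_apply_def]

theorem conj_markCycle {Y : Type*} [DecidableEq Y] {ρ : Perm (Y ⊕ Bool)}
    (hρ : ∀ b, ρ (Sum.inr b) = Sum.inr b) {x y : Y} (hxy : ρ (Sum.inl x) = Sum.inl y) :
    ρ * markCycle x * ρ⁻¹ = markCycle y := by
  rw [markCycle, markCycle, ← hxy, ← hρ true, ← hρ false, swap_apply_apply, swap_apply_apply,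
    hρ, hρ]
  group

theorem markCycle_injective {Y : Type*} [DecidableEq Y] :
    Function.Injective (markCycle : Y → Perm (Y ⊕ Bool)) := by
  intro x y h
  by_contra hxy
  have := congrFun (congrArg DFunLike.coe h) (Sum.inl x)
  simp [markCycle, swap_apply_def, hxy] at this

/-- Four mark cycles suffice to make a 3-cycle that fixes the spare points, so conjugation by it
permutes the mark cycles. -/
theorem markCycle_product {Y : Type*} [DecidableEq Y] {a b c : Y} (hab : a ≠ b) (hbc : b ≠ c)
    (hac : a ≠ c) :
    markCycle b * (markCycle a)⁻¹ * markCycle c * (markCycle b)⁻¹ =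
      sumCongr (swap a b * swap b c) 1 := by
  refine Equiv.ext fun v => ?_
  simp only [markCycle, mul_inv_rev, swap_inv, Perm.mul_apply]
  have := hab.symm
  have := hbc.symm
  have := hac.symm
  rcases v with v | t
  · by_cases h₁ : v = a
    · subst h₁; simp [swap_apply_def, *]
    by_cases h₂ : v = b
    · subst h₂; simp [swap_apply_def, *]
    by_cases h₃ : v = c
    · subst h₃; simp [swap_apply_def, *]
    simp [swap_apply_def, *]
  · cases t <;> simp [swap_apply_def, *]

/-- If conjugation by short elements induces all `3`-cycles on a family of short elements, then
every finite group receiving a local embedding has at least as many elements as the alternating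
group of the index set. -/
theorem factorial_le_of_isLocalEmbedding {Γ Y : Type*} [Group Γ] [Fintype Y] [DecidableEq Y]
    [Nontrivial Y] {C : Y → Γ} (hC : Function.Injective C)
    (hconj : ∀ a b c : Y, a ≠ b → b ≠ c → a ≠ c → ∀ v,
      C b * (C a)⁻¹ * C c * (C b)⁻¹ * C v =
        C ((swap a b * swap b c) v) * (C b * (C a)⁻¹ * C c * (C b)⁻¹))
    {S : Set Γ} {n : ℕ} (hS : ∀ x, C x ∈ wordBall S n) {Q : Type*} [Group Q] [Finite Q]
    {π : Γ → Q} (hπ : IsLocalEmbedding (wordBall S (5 * n)) π) :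
    (Fintype.card Y).factorial ≤ 2 * Nat.card Q := by
  have hS' : ∀ x, C x ∈ wordBall S (5 * n) := fun x => wordBall_mono S (by omega) (hS x)
  -- The conjugator `q` ranges over all of `Q`, not over the image of a ball. Closure under products
  -- is therefore free, and only the bounded-length relations for 3-cycles need to be transported.
  let P : Subgroup (Perm Y) :=
    { carrier := {σ | ∃ q : Q, ∀ v, q * π (C v) * q⁻¹ = π (C (σ v))}
      one_mem' := ⟨1, by simp⟩
      mul_mem' := by
        rintro σ τ ⟨q, hq⟩ ⟨r, hr⟩
        refine ⟨q * r, fun v => ?_⟩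
        rw [Perm.mul_apply, ← hq, ← hr]
        group
      inv_mem' := by
        rintro σ ⟨q, hq⟩
        refine ⟨q⁻¹, fun v => ?_⟩
        have := hq (σ⁻¹ v)
        rw [← Perm.mul_apply, mul_inv_cancel, Perm.one_apply] at this
        rw [← this]
        group }
  have hP : alternatingGroup Y ≤ P := by
    rw [← Perm.closure_three_cycles_eq_alternating, Subgroup.closure_le]
    intro σ hσ
    obtain ⟨a, ha⟩ := hσ.isCycle.nonempty_support
    have hσa := (hσ.eq_swap_mul_swap_iff_mem_support).2 ha
    have hnd := (hσ.nodup_iff_mem_support).2 ha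
    simp only [List.nodup_cons, List.mem_cons, List.not_mem_nil, or_false, not_or] at hnd
    generalize σ a = b at hσa hnd
    generalize σ b = c at hσa hnd
    obtain ⟨⟨hab, hac⟩, hbc, -⟩ := hnd
    subst hσa
    have hd : C b * (C a)⁻¹ * C c * (C b)⁻¹ ∈ wordBall S (4 * n) := by
      rw [show 4 * n = n + n + n + n by ring]
      exact mul_mem_wordBall (mul_mem_wordBall (mul_mem_wordBall (hS b)
        (inv_mem_wordBall (hS a))) (hS c)) (inv_mem_wordBall (hS b))
    refine ⟨π (C b * (C a)⁻¹ * C c * (C b)⁻¹), fun v => ?_⟩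
    have hd' := wordBall_mono S (show 4 * n ≤ 5 * n by omega) hd
    rw [mul_inv_eq_iff_eq_mul, ← hπ.map_mul _ hd' _ (hS' v), hconj a b c hab hbc hac,
      hπ.map_mul _ (hS' _) _ hd']
    · rw [show 5 * n = n + 4 * n by ring]
      exact mul_mem_wordBall (hS _) hd
    · rw [show 5 * n = 4 * n + n by ring]
      exact mul_mem_wordBall hd (hS v)
  -- `q` need not be a homomorphism; it is injective because conjugation by `q σ` determines `σ`.
  choose q hq using fun σ : alternatingGroup Y => hP σ.2
  have hq' : Function.Injective q := by
    intro σ τ h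
    refine Subtype.ext (Equiv.ext fun v => hC (hπ.injOn (hS' _) (hS' _) ?_))
    rw [← hq, ← hq, h]
  rw [← Fintype.card_perm, ← Nat.card_eq_fintype_card, ← two_mul_nat_card_alternatingGroup]
  exact Nat.mul_le_mul_left 2 (Nat.card_le_card_of_injective q hq')

end LowerBound

/-! ### The diagonal groups and bounds for their LEF growth. -/

section LampGroup

open Equiv

/-- The product of the symmetric groups of the spaces with parameters `2 ^ k` and `m k`. -/
abbrev LampProduct (m : ℕ → ℕ) : Type := ∀ k, Perm (LampSpace (2 ^ k) (m k))

def letterProduct (m : ℕ → ℕ) (s : Letter) : LampProduct m := fun k => letterPerm (2 ^ k) (m k) s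

/-- The group generated by the letters, acting diagonally on all the spaces. -/
def lampGroup (m : ℕ → ℕ) : Subgroup (LampProduct m) :=
  Subgroup.closure (Set.range (letterProduct m))

def lampGen (m : ℕ → ℕ) (s : Letter) : lampGroup m :=
  ⟨letterProduct m s, Subgroup.subset_closure ⟨s, rfl⟩⟩

def lampGens (m : ℕ → ℕ) : Set (lampGroup m) := Set.range (lampGen m)

theorem lampGens_finite (m : ℕ → ℕ) : (lampGens m).Finite := by
  have h : (Set.univ : Set Letter) ⊆
      {.shift, .unshift, .toggle, .mark true, .mark false} := by
    rintro (_ | _ | _ | (_ | _)) - <;> simp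
  rw [lampGens, ← Set.image_univ]
  exact ((Set.toFinite _).subset h).image _

theorem closure_lampGens (m : ℕ → ℕ) : Subgroup.closure (lampGens m) = ⊤ := by
  have h : lampGens m = Subtype.val ⁻¹' Set.range (letterProduct m) := by
    ext g
    constructor
    · rintro ⟨s, rfl⟩
      exact ⟨s, rfl⟩
    · rintro ⟨s, hs⟩
      exact ⟨s, Subtype.ext hs⟩
  rw [h]
  exact Subgroup.closure_closure_coe_preimage

def Letter.inv : Letter → Letter
  | .shift => .unshift
  | .unshift => .shift
  | .toggle => .toggle
  | .mark b => .mark b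

theorem letterPerm_inv (l m : ℕ) (s : Letter) :
    letterPerm l m s.inv = (letterPerm l m s)⁻¹ := by
  cases s with
  | shift => rfl
  | unshift => exact (inv_inv _).symm
  | toggle =>
    rw [eq_inv_iff_mul_eq_one]
    refine Equiv.ext fun x => ?_
    rcases x with x | b
    · exact congrArg Sum.inl (toggleFun_involutive l m x)
    · rfl
  | mark b => simp [Letter.inv, letterPerm_mark]

theorem exists_word_of_mem_wordBall {m : ℕ → ℕ} {n : ℕ} {g : lampGroup m}
    (hg : g ∈ wordBall (lampGens m) n) :
    ∃ w : List Letter, w.length ≤ n ∧ ∀ k, (g : LampProduct m) k = wordPerm (2 ^ k) (m k) w := by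
  obtain ⟨l, hl, hS, rfl⟩ := hg
  suffices h : ∃ w : List Letter, w.length = l.length ∧
      ∀ k, (l.prod : LampProduct m) k = wordPerm (2 ^ k) (m k) w by
    obtain ⟨w, hw, h⟩ := h
    exact ⟨w, hw.trans_le hl, h⟩
  clear hl
  induction l with
  | nil => exact ⟨[], rfl, fun k => rfl⟩
  | cons x l ih =>
    obtain ⟨w, hw, h⟩ := ih fun y hy => hS y (by simp [hy])
    have hx : ∃ s : Letter, ∀ k, (x : LampProduct m) k = letterPerm (2 ^ k) (m k) s := by
      rcases hS x (by simp) with ⟨s, hs⟩ | ⟨s, hs⟩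
      · exact ⟨s, fun k => by rw [← hs]; rfl⟩
      · refine ⟨s.inv, fun k => ?_⟩
        rw [letterPerm_inv, eq_comm, inv_eq_iff_eq_inv]
        exact congrArg (fun y : lampGroup m => (y : LampProduct m) k) hs
    obtain ⟨s, hs⟩ := hx
    refine ⟨s :: w, by simp [hw], fun k => ?_⟩
    rw [List.prod_cons, Subgroup.coe_mul, Pi.mul_apply, hs, h]
    simp [wordPerm]

/-- All factors up to `k` are kept: an element supported in a smaller factor is invisible in factor
`k`. -/
def lampProj (m : ℕ → ℕ) (k : ℕ) :
    lampGroup m →* (∀ i : Fin (k + 1), Perm (LampSpace (2 ^ (i : ℕ)) (m i))) where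
  toFun g i := (g : LampProduct m) i
  map_one' := rfl
  map_mul' _ _ := rfl

/-- Injectivity concerns `g * g'⁻¹`, of length at most `2 * n`; later factors are controlled by
factor `k`. -/
theorem isLocalEmbedding_lampProj {m : ℕ → ℕ} (hm : ∀ k, m k < 2 ^ k) {n k : ℕ}
    (h : 2 * n ≤ 2 ^ k) : IsLocalEmbedding (wordBall (lampGens m) n) (lampProj m k) := by
  refine ⟨fun g _ g' _ _ => map_mul _ _ _, fun g hg g' hg' heq => ?_⟩
  obtain ⟨w, hw, hgw⟩ := exists_word_of_mem_wordBall
    (mul_mem_wordBall hg (inv_mem_wordBall hg'))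
  have hi : ∀ i ≤ k, (g : LampProduct m) i = (g' : LampProduct m) i := fun i hi =>
    congrFun heq ⟨i, Nat.lt_succ_of_le hi⟩
  have hk : wordPerm (2 ^ k) (m k) w = 1 := by
    rw [← hgw k, Subgroup.coe_mul, Pi.mul_apply, hi k le_rfl, Subgroup.coe_inv, Pi.inv_apply,
      mul_inv_cancel]
  refine Subtype.ext (funext fun j => ?_)
  rcases le_total j k with hj | hj
  · exact hi j hj
  · have := wordPerm_eq_one_of_le (hm k) (hm j) (Nat.pow_le_pow_right two_pos hj)
      (hw.trans (by omega)) hk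
    rw [← hgw j, Subgroup.coe_mul, Pi.mul_apply, Subgroup.coe_inv, Pi.inv_apply] at this
    exact mul_inv_eq_one.1 this

/-- The number of configurations on the cycle of the `k`-th space. -/
def lampCard (m : ℕ → ℕ) (k : ℕ) : ℕ := 2 ^ (k + 5 + m k)

theorem card_lampConfig (m : ℕ → ℕ) (k : ℕ) :
    Fintype.card (ZMod (16 * 2 ^ k) × (Fin (m k + 1) → ZMod 2)) = lampCard m k := by
  rw [Fintype.card_prod, ZMod.card, Fintype.card_fun, ZMod.card, Fintype.card_fin, lampCard]
  ring

theorem lefGrowth_lampGens_le {m : ℕ → ℕ} (hm : ∀ k, m k < 2 ^ k) {n k : ℕ}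
    (h : 2 * n ≤ 2 ^ k) :
    lefGrowth (lampGens m) n ≤
      ((∏ i ∈ Finset.range (k + 1), (lampCard m i + 2).factorial : ℕ) : ℕ∞) := by
  refine (lefGrowth_le_natCard (isLocalEmbedding_lampProj hm h)).trans (le_of_eq ?_)
  rw [Nat.card_pi, Finset.prod_range]
  congr 1
  refine Finset.prod_congr rfl fun i _ => ?_
  rw [Nat.card_eq_fintype_card, Fintype.card_perm, Fintype.card_sum, card_lampConfig,
    Fintype.card_bool]

theorem isLEF_lampGroup {m : ℕ → ℕ} (hm : ∀ k, m k < 2 ^ k) : IsLEF (lampGroup m) :=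
  isLEF_of_wordBall (closure_lampGens m) fun n =>
    ⟨_, inferInstance, inferInstance, lampProj m (2 * n),
      isLocalEmbedding_lampProj hm (Nat.lt_two_pow_self).le⟩

/-- Some element of length at most `n` fixes the additional points of the `k`-th space and
sends `x` to `y`. -/
def Reaches (m : ℕ → ℕ) (k n : ℕ) (x y : ZMod (16 * 2 ^ k) × (Fin (m k + 1) → ZMod 2)) : Prop :=
  ∃ g ∈ wordBall (lampGens m) n, (g : LampProduct m) k (Sum.inl x) = Sum.inl y ∧
    ∀ b, (g : LampProduct m) k (Sum.inr b) = Sum.inr b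

theorem Reaches.refl (m : ℕ → ℕ) (k n : ℕ) (x) : Reaches m k n x x :=
  ⟨1, one_mem_wordBall _ _, rfl, fun _ => rfl⟩

theorem Reaches.trans {m : ℕ → ℕ} {k n n' : ℕ} {x y z} (h : Reaches m k n x y)
    (h' : Reaches m k n' y z) : Reaches m k (n + n') x z := by
  obtain ⟨g, hg, hxy, hb⟩ := h
  obtain ⟨g', hg', hyz, hb'⟩ := h'
  refine ⟨g' * g, add_comm n n' ▸ mul_mem_wordBall hg' hg, ?_, fun b => ?_⟩
  · rw [Subgroup.coe_mul, Pi.mul_apply, Perm.mul_apply, hxy, hyz]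
  · rw [Subgroup.coe_mul, Pi.mul_apply, Perm.mul_apply, hb, hb']

theorem reaches_shift (m : ℕ → ℕ) (k n : ℕ) (p : ZMod (16 * 2 ^ k)) (c) :
    Reaches m k n (p, c) (p + n, c) := by
  induction n with
  | zero => simpa using Reaches.refl m k 0 (p, c)
  | succ n ih =>
    refine ih.trans ⟨lampGen m .shift, mem_wordBall_of_mem ⟨_, rfl⟩, ?_, fun b => rfl⟩
    push_cast
    rw [← add_assoc]
    rfl

theorem reaches_toggle (m : ℕ → ℕ) (k : ℕ) (x) :
    Reaches m k 1 x (toggleFun (2 ^ k) (m k) x) :=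
  ⟨lampGen m .toggle, mem_wordBall_of_mem ⟨_, rfl⟩, rfl, fun _ => rfl⟩

theorem Reaches.mono {m : ℕ → ℕ} {k n n' : ℕ} {x y} (h : Reaches m k n x y) (hn : n ≤ n') :
    Reaches m k n' x y := by
  obtain ⟨g, hg, h⟩ := h
  exact ⟨g, wordBall_mono _ hn hg, h⟩

/-- After the walk to the first site, each site costs at most two letters: a toggle if needed, and a
shift. -/
theorem reaches_sites {m : ℕ → ℕ} {k : ℕ} (hm : m k < 2 ^ k) (c : Fin (m k + 1) → ZMod 2) (i : ℕ)
    (hi : i ≤ m k + 1) :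
    Reaches m k (4 * 2 ^ k + 2 * i) (0, 0)
      (((4 * 2 ^ k + i : ℕ) : ZMod (16 * 2 ^ k)), fun r => if (r : ℕ) < i then c r else 0) := by
  induction i with
  | zero => simpa using! reaches_shift m k (4 * 2 ^ k) 0 0
  | succ i ih =>
    rw [show 4 * 2 ^ k + 2 * (i + 1) = 4 * 2 ^ k + 2 * i + (1 + 1) by ring]
    refine (ih (by omega)).trans ?_
    suffices h : Reaches m k 1
        (((4 * 2 ^ k + i : ℕ) : ZMod (16 * 2 ^ k)), fun r => if (r : ℕ) < i then c r else 0)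
        (((4 * 2 ^ k + i : ℕ) : ZMod (16 * 2 ^ k)), fun r => if (r : ℕ) < i + 1 then c r else 0) by
      have h' := h.trans (reaches_shift m k 1 _ _)
      rw [← add_assoc]
      push_cast at h' ⊢
      exact h'
    have him : i < m k + 1 := by omega
    have hm' : (m k : ℤ) < 2 ^ k := by exact_mod_cast hm
    by_cases hc : c ⟨i, him⟩ = 0
    · convert Reaches.refl m k 1 _ using 2
      funext r
      by_cases h₁ : (r : ℕ) < i
      · simp [h₁, Nat.lt_succ_of_lt h₁]
      by_cases h₂ : (r : ℕ) = i
      · have : r = ⟨i, him⟩ := Fin.ext h₂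
        subst this
        simp [hc]
      · rw [if_neg (by omega), if_neg (by omega)]
    · convert reaches_toggle m k _ using 1
      refine Prod.ext rfl (funext fun r => ?_)
      have hr := r.2
      have hiff : ((4 * 2 ^ k + i : ℕ) : ZMod (16 * 2 ^ k)) =
          ((4 * (2 ^ k : ℕ) + r : ℤ) : ZMod (16 * 2 ^ k)) ↔ i = r := by
        have := zmod_intCast_inj (N := 16 * 2 ^ k) (a := (4 * 2 ^ k + i : ℕ))
          (b := (4 * (2 ^ k : ℕ) + r : ℤ)) (by push_cast; omega) (by push_cast; omega)
        rw [Int.cast_natCast] at this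
        rw [this]
        push_cast
        omega
      simp only [toggleFun, hiff]
      by_cases h₂ : i = r
      · have hr : r = ⟨i, him⟩ := Fin.ext h₂.symm
        subst hr
        have h2 : ∀ z : ZMod 2, z ≠ 0 → z = 0 + 1 := by decide
        simpa using h2 _ hc
      · rw [if_neg h₂]
        by_cases h₁ : (r : ℕ) < i
        · rw [if_pos h₁, if_pos (by omega)]
        · rw [if_neg h₁, if_neg (by omega)]

/-- Setting the lamps costs at most `6 * 2 ^ k`, and the final walk less than one turn, `16 * 2 ^
k`. -/
theorem reaches_all {m : ℕ → ℕ} {k : ℕ} (hm : m k < 2 ^ k) (y) :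
    Reaches m k (22 * 2 ^ k) (0, 0) y := by
  obtain ⟨p, c⟩ := y
  have h₁ := reaches_sites hm c (m k + 1) le_rfl
  have h₂ := reaches_shift m k (p - ((4 * 2 ^ k + (m k + 1) : ℕ) : ZMod (16 * 2 ^ k))).val
    ((4 * 2 ^ k + (m k + 1) : ℕ) : ZMod (16 * 2 ^ k)) c
  rw [ZMod.natCast_val, ZMod.cast_id', id, add_sub_cancel] at h₂
  have h₃ : (fun r : Fin (m k + 1) => if (r : ℕ) < m k + 1 then c r else 0) = c := by
    funext r
    rw [if_pos r.2]
  rw [h₃] at h₁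
  refine (h₁.trans h₂).mono ?_
  have := ZMod.val_lt (p - ((4 * 2 ^ k + (m k + 1) : ℕ) : ZMod (16 * 2 ^ k)))
  omega

theorem shiftPerm_pow_inl (l m n : ℕ) (p : ZMod (16 * l)) (c) :
    (shiftPerm l m ^ n) (Sum.inl (p, c)) = Sum.inl (p + n, c) := by
  induction n with
  | zero => simp
  | succ n ih =>
    rw [pow_succ', Perm.mul_apply, ih]
    push_cast
    rw [← add_assoc]
    rfl

theorem shiftPerm_pow_inr (l m n : ℕ) (b : Bool) :
    (shiftPerm l m ^ n) (Sum.inr b) = Sum.inr b := by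
  induction n with
  | zero => simp
  | succ n ih =>
    rw [pow_succ', Perm.mul_apply, ih]
    rfl

/-- The commutator of the two marks, after one of them is moved along half of the `k`-th cycle,
acts only on the `k`-th space. -/
theorem exists_markCycle_zero (m : ℕ → ℕ) (k : ℕ) :
    ∃ g ∈ wordBall (lampGens m) (36 * 2 ^ k),
      (g : LampProduct m) = MonoidHom.mulSingle _ k (markCycle (0, 0)) := by
  set T := lampGen m .shift ^ (8 * 2 ^ k) with hT
  set A := lampGen m (.mark false) with hA
  set B := T⁻¹ * lampGen m (.mark true) * T with hB
  have hTb : T ∈ wordBall (lampGens m) (8 * 2 ^ k) := by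
    simpa using pow_mem_wordBall (mem_wordBall_of_mem (S := lampGens m) ⟨Letter.shift, rfl⟩)
      (8 * 2 ^ k)
  have hAb : A ∈ wordBall (lampGens m) 1 := mem_wordBall_of_mem ⟨_, rfl⟩
  have hBb : B ∈ wordBall (lampGens m) (8 * 2 ^ k + 1 + 8 * 2 ^ k) :=
    mul_mem_wordBall (mul_mem_wordBall (inv_mem_wordBall hTb) (mem_wordBall_of_mem ⟨_, rfl⟩)) hTb
  refine ⟨A * B * A * B, wordBall_mono _ ?_
    (mul_mem_wordBall (mul_mem_wordBall (mul_mem_wordBall hAb hBb) hAb) hBb), ?_⟩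
  · have := Nat.one_le_two_pow (n := k)
    omega
  have hBj : ∀ j, (B : LampProduct m) j =
      swap (Sum.inl (((8 * 2 ^ j - 8 * 2 ^ k : ℤ) : ZMod (16 * 2 ^ j)), 0)) (Sum.inr true) := by
    intro j
    have hTj : (T : LampProduct m) j = shiftPerm (2 ^ j) (m j) ^ (8 * 2 ^ k) := rfl
    have h₁ : basePoint (2 ^ j) (m j) true =
        (T : LampProduct m) j
          (Sum.inl (((8 * 2 ^ j - 8 * 2 ^ k : ℤ) : ZMod (16 * 2 ^ j)), 0)) := by
      rw [hTj, shiftPerm_pow_inl, basePoint, center]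
      push_cast
      rw [sub_add_cancel]
    have h₂ : (Sum.inr true : LampSpace (2 ^ j) (m j)) =
        (T : LampProduct m) j (Sum.inr true) := by
      rw [hTj, shiftPerm_pow_inr]
    change ((T : LampProduct m) j)⁻¹ * swap (basePoint (2 ^ j) (m j) true) (Sum.inr true) *
      (T : LampProduct m) j = _
    rw [h₁]
    nth_rewrite 1 [h₂]
    rw [swap_apply_apply]
    group
  have hAj : ∀ j, (A : LampProduct m) j = swap (Sum.inl (0, 0)) (Sum.inr false) := by
    intro j
    change swap (basePoint (2 ^ j) (m j) false) (Sum.inr false) = _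
    simp [basePoint, center]
  funext j
  change (A : LampProduct m) j * (B : LampProduct m) j * (A : LampProduct m) j *
    (B : LampProduct m) j = _
  rw [hAj, hBj, MonoidHom.mulSingle_apply]
  by_cases hjk : j = k
  · subst hjk
    rw [Pi.mulSingle_eq_same, sub_self, Int.cast_zero, markCycle_eq_commutator]
  · rw [Pi.mulSingle_eq_of_ne hjk]
    -- Here the powers of two matter: a shift by `8 * 2 ^ k` is a whole number of turns if `j < k`
    -- and less than half a turn if `j > k`, so the marks do not meet.
    have hne : ((8 * 2 ^ j - 8 * 2 ^ k : ℤ) : ZMod (16 * 2 ^ j)) ≠ 0 := by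
      intro h
      rw [ZMod.intCast_zmod_eq_zero_iff_dvd] at h
      push_cast at h
      rw [← mul_sub, show (16 * 2 ^ j : ℤ) = 8 * 2 ^ (j + 1) by ring,
        mul_dvd_mul_iff_left (by norm_num)] at h
      rcases lt_or_gt_of_ne hjk with hlt | hlt
      · have h' : (2 : ℤ) ^ (j + 1) ∣ 2 ^ k := pow_dvd_pow 2 hlt
        have := Int.le_of_dvd (by positivity) ((dvd_sub_left h').1 h)
        rw [pow_succ] at this
        have : (0 : ℤ) < 2 ^ j := by positivity
        omega
      · have := Int.le_of_dvd (sub_pos.2 (pow_lt_pow_right₀ (by norm_num) hlt)) h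
        rw [pow_succ] at this
        have : (0 : ℤ) < 2 ^ j := by positivity
        have : (0 : ℤ) < 2 ^ k := by positivity
        omega
    generalize ((8 * 2 ^ j - 8 * 2 ^ k : ℤ) : ZMod (16 * 2 ^ j)) = p at hne
    have hd : Perm.Disjoint
        (swap (Sum.inl (0, 0)) (Sum.inr false) : Perm (LampSpace (2 ^ j) (m j)))
        (swap (Sum.inl (p, 0)) (Sum.inr true)) := by
      rw [Perm.disjoint_iff_disjoint_support, Perm.support_swap (by simp),
        Perm.support_swap (by simp)]
      simp [hne]
    rw [mul_assoc, mul_assoc, ← mul_assoc (swap (Sum.inl (p, 0)) (Sum.inr true)), ← hd.commute.eq]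
    simp [mul_assoc]

/-- The conjugator acts in every factor, but conjugation preserves triviality outside factor `k`. -/
theorem exists_markCycle {m : ℕ → ℕ} {k : ℕ} (hm : m k < 2 ^ k)
    (x : ZMod (16 * 2 ^ k) × (Fin (m k + 1) → ZMod 2)) :
    ∃ g ∈ wordBall (lampGens m) (80 * 2 ^ k),
      (g : LampProduct m) = MonoidHom.mulSingle _ k (markCycle x) := by
  obtain ⟨z, hz, hzc⟩ := exists_markCycle_zero m k
  obtain ⟨g, hg, hgx, hgb⟩ := reaches_all hm x
  refine ⟨g * z * g⁻¹, ?_, ?_⟩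
  · rw [show 80 * 2 ^ k = 22 * 2 ^ k + 36 * 2 ^ k + 22 * 2 ^ k by ring]
    exact mul_mem_wordBall (mul_mem_wordBall hg hz) (inv_mem_wordBall hg)
  · rw [Subgroup.coe_mul, Subgroup.coe_mul, hzc]
    funext j
    rw [Pi.mul_apply, Pi.mul_apply, Subgroup.coe_inv, Pi.inv_apply, MonoidHom.mulSingle_apply,
      MonoidHom.mulSingle_apply]
    by_cases hjk : j = k
    · subst hjk
      rw [Pi.mulSingle_eq_same, Pi.mulSingle_eq_same, conj_markCycle hgb hgx]
    · rw [Pi.mulSingle_eq_of_ne hjk, Pi.mulSingle_eq_of_ne hjk]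
      simp

/-- The constant is `400 = 5 * 80`: relations among mark cycles of length `80 * 2 ^ k` are needed up
to five factors. -/
theorem le_lefGrowth_lampGens {m : ℕ → ℕ} (hm : ∀ k, m k < 2 ^ k) {n k : ℕ}
    (h : 400 * 2 ^ k ≤ n) :
    (((lampCard m k).factorial / 2 : ℕ) : ℕ∞) ≤ lefGrowth (lampGens m) n := by
  refine le_sInf ?_
  rintro q ⟨Q, _, _, ⟨π, hπ⟩, rfl⟩
  choose C hC hCm using fun x => exists_markCycle (m := m) (hm k) x
  have hinj : Function.Injective C := by
    intro x y hxy
    refine markCycle_injective ?_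
    have := congrArg (fun g : lampGroup m => (g : LampProduct m) k) hxy
    simpa only [hCm, MonoidHom.mulSingle_apply, Pi.mulSingle_eq_same] using this
  have : Fact (1 < 16 * 2 ^ k) := ⟨by have := Nat.one_le_two_pow (n := k); omega⟩
  have key := factorial_le_of_isLocalEmbedding hinj (fun a b c hab hbc hac v => by
      refine Subtype.ext ?_
      simp only [Subgroup.coe_mul, Subgroup.coe_inv, hCm, ← map_mul, ← map_inv]
      rw [markCycle_product hab hbc hac, ← mul_inv_eq_iff_eq_mul.1
        (conj_markCycle (ρ := sumCongr (swap a b * swap b c) 1) (fun _ => rfl) rfl)])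
    hC (hπ.mono (wordBall_mono _ (by omega)))
  rw [card_lampConfig] at key
  exact_mod_cast Nat.div_le_of_le_mul key

end LampGroup

/-! ### Tuning the number of lamps to a prescribed growth. -/

section Growth

open Filter

theorem two_mul_three_pow_le_factorial {n : ℕ} (hn : 8 ≤ n) : 2 * 3 ^ n ≤ n.factorial := by
  induction n, hn using Nat.le_induction with
  | base => decide
  | succ n hn ih =>
    rw [Nat.factorial_succ, pow_succ]
    nlinarith

theorem two_mul_half_factorial {n : ℕ} (hn : 8 ≤ n) : 2 * (n.factorial / 2) = n.factorial :=
  Nat.mul_div_cancel' (Nat.dvd_factorial two_pos (by omega))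

/-- One more lamp doubles `N`, which costs only a bounded power. The exponent `8 = 2 ^ 3` is what
three doublings of the argument of `f` pay for. -/
theorem factorial_two_mul_add_two_le {n : ℕ} (hn : 8 ≤ n) :
    (2 * n + 2).factorial ≤ (n.factorial / 2) ^ 8 := by
  have h₁ := two_mul_three_pow_le_factorial hn
  have h₂ := two_mul_half_factorial hn
  generalize n.factorial / 2 = d at h₂
  have hd : 3 ^ n ≤ d := by omega
  have h₃ : (2 * n).factorial ≤ 4 ^ n * (4 * d ^ 2) := by
    have h := Nat.choose_mul_factorial_mul_factorial (show n ≤ 2 * n by omega)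
    have hc := Nat.choose_le_two_pow (2 * n) n
    rw [pow_mul] at hc
    rw [show 2 * n - n = n by omega, ← h₂] at h
    rw [← h]
    calc _ = (2 * n).choose n * (4 * d ^ 2) := by ring
      _ ≤ _ := Nat.mul_le_mul_right _ hc
  have h₄ : (2 * n + 2) * (2 * n + 1) ≤ 4 ^ n := by
    clear h₁ h₂ h₃ hd
    induction n, hn using Nat.le_induction with
    | base => decide
    | succ n hn ih => rw [pow_succ]; nlinarith
  have h₅ : 16 ^ n ≤ d ^ 3 := by
    calc 16 ^ n ≤ 27 ^ n := Nat.pow_le_pow_left (by norm_num) n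
      _ = (3 ^ n) ^ 3 := by rw [← pow_mul, mul_comm, pow_mul]; norm_num
      _ ≤ d ^ 3 := Nat.pow_le_pow_left hd 3
  have hd2 : 4 ≤ d := by
    have : 3 ^ 8 ≤ 3 ^ n := Nat.pow_le_pow_right (by norm_num) hn
    norm_num at this
    omega
  calc (2 * n + 2).factorial = (2 * n + 2) * (2 * n + 1) * (2 * n).factorial := by
        rw [Nat.factorial_succ, Nat.factorial_succ]; ring
    _ ≤ 4 ^ n * (4 ^ n * (4 * d ^ 2)) := Nat.mul_le_mul h₄ h₃
    _ = 16 ^ n * (4 * d ^ 2) := by rw [← mul_assoc, ← mul_pow]; norm_num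
    _ ≤ d ^ 3 * (d * d ^ 2) := Nat.mul_le_mul h₅ (Nat.mul_le_mul_right _ hd2)
    _ = d ^ 6 * 1 := by ring
    _ ≤ d ^ 6 * d ^ 2 := Nat.mul_le_mul_left _ (Nat.one_le_pow _ _ (by omega))
    _ = d ^ 8 := by ring

theorem exp_le_half_factorial {n : ℕ} (hn : 8 ≤ n) :
    Real.exp n ≤ ((n.factorial / 2 : ℕ) : ℝ) := by
  have h₁ := two_mul_three_pow_le_factorial hn
  have h₂ := two_mul_half_factorial hn
  have h₃ : 3 ^ n ≤ n.factorial / 2 := by omega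
  calc Real.exp n = Real.exp 1 ^ n := by rw [← Real.exp_nat_mul, mul_one]
    _ ≤ 3 ^ n := pow_le_pow_left₀ (Real.exp_pos _).le
        (Real.exp_one_lt_d9.le.trans (by norm_num)) n
    _ ≤ _ := by exact_mod_cast h₃

theorem factorial_two_pow_add_two_le (k : ℕ) :
    (((2 ^ (k + 5) + 2).factorial : ℕ) : ℝ) ≤
      Real.exp (64 * 2 ^ k * Real.log (64 * 2 ^ k)) := by
  have h₁ : 2 ^ (k + 5) + 2 ≤ 64 * 2 ^ k := by
    have := Nat.one_le_two_pow (n := k)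
    rw [pow_add]
    omega
  have h₂ : (2 ^ (k + 5) + 2).factorial ≤ (64 * 2 ^ k) ^ (64 * 2 ^ k) :=
    (Nat.factorial_le h₁).trans (Nat.factorial_le_pow _)
  have h₃ : (0 : ℝ) < 64 * 2 ^ k := by positivity
  calc (((2 ^ (k + 5) + 2).factorial : ℕ) : ℝ) ≤ (64 * 2 ^ k : ℝ) ^ (64 * 2 ^ k : ℕ) := by
        exact_mod_cast h₂
    _ = Real.exp (64 * 2 ^ k * Real.log (64 * 2 ^ k)) := by
        rw [← Real.rpow_natCast, Real.rpow_def_of_pos h₃, mul_comm]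
        push_cast
        rfl

/-- Every sufficiently regular function between `x * log x` and `2 ^ x` is, up to equivalence,
the logarithm of the LEF growth of one of the groups `lampGroup m`. -/
theorem exists_growthEquiv {f : ℝ → ℝ} (hf : MonotoneOn f (Set.Ici 1))
    (hdouble : ∀ᶠ x in atTop, 2 * f x ≤ f (2 * x))
    (hlow : ∀ᶠ x in atTop, x * Real.log x ≤ f x)
    (hupp : ∀ᶠ x in atTop, f x ≤ 2 ^ x) :
    ∃ m : ℕ → ℕ, (∀ k, m k < 2 ^ k) ∧
      GrowthEquiv (lefGrowthReal (lampGens m)) (fun x => ENNReal.ofReal (Real.exp (f x))) := by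
  classical
  obtain ⟨x₀, hx₀⟩ := eventually_atTop.1 (hdouble.and (hlow.and hupp))
  obtain ⟨s, hs⟩ := pow_unbounded_of_one_lt x₀ (one_lt_two (α := ℝ))
  -- The factor `64` makes `m k = 0` admissible and leaves room to divide by 8; `2 ^ s` exceeds
  -- `x₀`.
  set M : ℝ := 64 * 2 ^ s with hM
  have hs1 : (1 : ℝ) ≤ 2 ^ s := one_le_pow₀ one_le_two
  have hk1 : ∀ k : ℕ, (1 : ℝ) ≤ 2 ^ k := fun k => one_le_pow₀ one_le_two
  have hMk : ∀ k : ℕ, 64 * x₀ ≤ M * 2 ^ k ∧ 64 * 2 ^ k ≤ M * 2 ^ k ∧ x₀ ≤ M * 2 ^ k := by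
    intro k
    have := hk1 k
    refine ⟨?_, ?_, ?_⟩ <;> rw [hM] <;> nlinarith
  let P : ℕ → ℕ → Prop := fun k j =>
    (((2 ^ (k + 5 + j) + 2).factorial : ℕ) : ℝ) ≤ Real.exp (f (M * 2 ^ k))
  have hP0 : ∀ k, P k 0 := by
    intro k
    have h64 : (1 : ℝ) ≤ 64 * 2 ^ k := by linarith [hk1 k]
    refine (factorial_two_pow_add_two_le k).trans (Real.exp_le_exp.2 ?_)
    refine le_trans ?_ (hx₀ _ (hMk k).2.2).2.1
    exact mul_le_mul (hMk k).2.1 (Real.log_le_log (by linarith) (hMk k).2.1)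
      (Real.log_nonneg h64) (by linarith [(hMk k).2.1])
  let m : ℕ → ℕ := fun k => Nat.findGreatest (P k) (2 ^ k - 1)
  have hm : ∀ k, m k < 2 ^ k := by
    intro k
    have : m k ≤ 2 ^ k - 1 := Nat.findGreatest_le _
    have := Nat.one_le_two_pow (n := k)
    omega
  have hPm : ∀ k, P k (m k) := fun k => Nat.findGreatest_spec (Nat.zero_le _) (hP0 k)
  refine ⟨m, hm, ?_, ?_⟩
  -- By doubling, the values `f (M * 2 ^ i)` grow at least geometrically, so their sum is at most
  -- twice the last.
  · have hprod : ∀ k, ((∏ i ∈ Finset.range (k + 1), (lampCard m i + 2).factorial : ℕ) : ℝ) ≤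
        Real.exp (2 * f (M * 2 ^ k)) := by
      intro k
      induction k with
      | zero =>
        have h₁ := hPm 0
        have h₂ : 0 ≤ f (M * 2 ^ 0) := by
          refine le_trans ?_ (hx₀ _ (hMk 0).2.2).2.1
          have := (hMk 0).2.1
          have h1 : (1 : ℝ) ≤ M * 2 ^ 0 := by linarith [hk1 0]
          exact mul_nonneg (by linarith) (Real.log_nonneg h1)
        rw [zero_add, Finset.prod_range_one]
        exact h₁.trans (Real.exp_le_exp.2 (by linarith))
      | succ k ih =>
        rw [Finset.prod_range_succ, Nat.cast_mul]
        have h₁ := (hx₀ _ (hMk k).2.2).1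
        have h₂ : 2 * (M * 2 ^ k) = M * 2 ^ (k + 1) := by ring
        rw [h₂] at h₁
        calc _ ≤ Real.exp (2 * f (M * 2 ^ k)) * Real.exp (f (M * 2 ^ (k + 1))) :=
              mul_le_mul ih (hPm (k + 1)) (Nat.cast_nonneg _) (Real.exp_pos _).le
          _ ≤ _ := by
              rw [← Real.exp_add]
              exact Real.exp_le_exp.2 (by linarith)
    -- With `2 ^ j ≤ x < 2 ^ (j + 1)`, factor `j + 2` is used, and one doubling absorbs the 2: `2 *
    -- M * 2 ^ (j + 2) ≤ 8 * M * x`.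
    refine ⟨8 * M, by linarith, fun x hx => ?_⟩
    obtain ⟨j, hj₁, hj₂⟩ := exists_nat_pow_near hx one_lt_two
    have hn : 2 * ⌈x⌉₊ ≤ 2 ^ (j + 2) := by
      have : ⌈x⌉₊ ≤ 2 ^ (j + 1) := Nat.ceil_le.2 (by exact_mod_cast hj₂.le)
      rw [pow_succ]
      omega
    have h₁ : lefGrowthReal (lampGens m) x ≤
        ((∏ i ∈ Finset.range (j + 2 + 1), (lampCard m i + 2).factorial : ℕ) : ℝ≥0∞) := by
      have := ENat.toENNReal_le.2 (lefGrowth_lampGens_le hm hn)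
      rwa [ENat.toENNReal_coe] at this
    refine h₁.trans ?_
    rw [← ENNReal.ofReal_natCast]
    refine ENNReal.ofReal_le_ofReal ((hprod _).trans (Real.exp_le_exp.2 ?_))
    refine (hx₀ _ (hMk _).2.2).1.trans (hf ?_ ?_ ?_)
    · have := hk1 (j + 2)
      have := (hMk (j + 2)).2.1
      exact Set.mem_Ici.2 (by linarith)
    · exact Set.mem_Ici.2 (by nlinarith)
    · rw [pow_add]
      nlinarith
  · refine ⟨400 * 2 ^ (s + 1), by linarith [hk1 (s + 1)], fun x hx => ?_⟩
    obtain ⟨j, hj₁, hj₂⟩ := exists_nat_pow_near hx one_lt_two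
    set k := j + 1 + s with hk
    have hkx : 2 ^ s * x ≤ 2 ^ k := by
      rw [hk, pow_add, mul_comm]
      exact mul_le_mul_of_nonneg_right hj₂.le (by linarith)
    have hkx' : x ≤ 2 ^ k := by nlinarith
    have hkx₀ : x₀ ≤ 2 ^ k := by nlinarith
    have hn : 400 * 2 ^ k ≤ ⌈400 * 2 ^ (s + 1) * x⌉₊ := by
      have h₁ : (400 * 2 ^ k : ℝ) ≤ 400 * 2 ^ (s + 1) * x := by
        rw [hk, show j + 1 + s = j + (s + 1) by ring, pow_add]
        have := hk1 (s + 1)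
        nlinarith
      have h₂ := h₁.trans (Nat.le_ceil _)
      exact_mod_cast h₂
    have h₁ : (((lampCard m k).factorial / 2 : ℕ) : ℝ≥0∞) ≤
        lefGrowthReal (lampGens m) (400 * 2 ^ (s + 1) * x) := by
      unfold lefGrowthReal
      exact_mod_cast le_lefGrowth_lampGens hm hn
    refine le_trans ?_ h₁
    rw [← ENNReal.ofReal_natCast]
    refine ENNReal.ofReal_le_ofReal ?_
    have hN : 8 ≤ lampCard m k := by
      calc 8 = 2 ^ 3 := rfl
        _ ≤ _ := Nat.pow_le_pow_right two_pos (by omega)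
    rcases Nat.lt_or_ge (m k) (2 ^ k - 1) with hlt | hge
    -- If the cap is not reached, maximality bounds `exp (f (8 * y))` by `(N! / 2) ^ 8`, while `8 *
    -- f y ≤ f (8 * y)`.
    · have hnP : ¬ P k (m k + 1) := Nat.findGreatest_is_greatest (Nat.lt_succ_self _) hlt
      have h₂ : (2 ^ (k + 5 + (m k + 1)) + 2).factorial ≤ ((lampCard m k).factorial / 2) ^ 8 := by
        rw [← add_assoc, pow_succ, mul_comm]
        exact factorial_two_mul_add_two_le hN
      have h₃ : Real.exp (f (M * 2 ^ k)) ≤ (((lampCard m k).factorial / 2 : ℕ) : ℝ) ^ 8 :=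
        (not_le.1 hnP).le.trans (by exact_mod_cast h₂)
      have hy : 8 * x₀ ≤ M * 2 ^ k / 8 := by linarith [(hMk k).1]
      have hy' : 8 * 2 ^ k ≤ M * 2 ^ k / 8 := by linarith [(hMk k).2.1]
      generalize hyd : M * 2 ^ k / 8 = y at hy hy'
      have hy₀ : x₀ ≤ y := by linarith [hk1 k]
      have hMy : M * 2 ^ k = 2 * (2 * (2 * y)) := by linarith
      have hy1 : 1 ≤ y := by linarith
      have d₁ := (hx₀ y hy₀).1
      have d₂ := (hx₀ (2 * y) (by linarith)).1
      have d₃ := (hx₀ (2 * (2 * y)) (by linarith)).1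
      have hfx : f x ≤ f y := hf hx hy1 (by linarith)
      rw [hMy] at h₃
      refine le_of_pow_le_pow_left₀ (n := 8) (by norm_num) (Nat.cast_nonneg _) (le_trans ?_ h₃)
      rw [← Real.exp_nat_mul]
      exact Real.exp_le_exp.2 (by push_cast; linarith)
    -- If the cap is reached, `N ≥ 2 ^ (2 ^ k)` already dominates `f`, by the upper bound on `f`.
    · refine le_trans (Real.exp_le_exp.2 ?_) (exp_le_half_factorial hN)
      have hle : 2 ^ (2 ^ k) ≤ lampCard m k := Nat.pow_le_pow_right two_pos (by omega)
      calc f x ≤ f (2 ^ k) := hf hx (hk1 k) hkx'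
        _ ≤ 2 ^ ((2 : ℝ) ^ k) := (hx₀ _ hkx₀).2.2
        _ = ((2 ^ (2 ^ k) : ℕ) : ℝ) := by
            rw [← Nat.cast_ofNat (R := ℝ), ← Nat.cast_pow, Real.rpow_natCast]
            push_cast
            rfl
        _ ≤ _ := by exact_mod_cast hle

/-- Every sufficiently regular function between `x * log x` and `2 ^ x` is, up to equivalence,
the logarithm of the LEF growth of a finitely generated group. -/
theorem exists_group_growthEquiv {f : ℝ → ℝ} (hf : MonotoneOn f (Set.Ici 1))
    (hdouble : ∀ᶠ x in atTop, 2 * f x ≤ f (2 * x))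
    (hlow : ∀ᶠ x in atTop, x * Real.log x ≤ f x)
    (hupp : ∀ᶠ x in atTop, f x ≤ 2 ^ x) :
    ∃ (Γ : Type) (_ : Group Γ), Group.FG Γ ∧ IsLEF Γ ∧
      ∀ S : Set Γ, S.Finite → Subgroup.closure S = ⊤ →
        GrowthEquiv (lefGrowthReal S) (fun x => ENNReal.ofReal (Real.exp (f x))) := by
  obtain ⟨m, hm, h⟩ := exists_growthEquiv hf hdouble hlow hupp
  exact ⟨lampGroup m, inferInstance,
    Group.fg_iff.2 ⟨lampGens m, closure_lampGens m, lampGens_finite m⟩, isLEF_lampGroup hm,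
    fun S hS hS' => growthEquiv_of_generating (lampGens_finite m) (closure_lampGens m) hS hS' h⟩

end Growth

/-! ### Regularity of the three target functions. -/

section Functions

open Filter Real

theorem exists_group_rpow {α : ℝ} (hα : 1 < α) :
    ∃ (Γ : Type) (_ : Group Γ), Group.FG Γ ∧ IsLEF Γ ∧
      ∀ S : Set Γ, S.Finite → Subgroup.closure S = ⊤ →
        GrowthEquiv (lefGrowthReal S) (fun x => ENNReal.ofReal (exp (x ^ α))) := by
  refine exists_group_growthEquiv (f := fun x => x ^ α) ?_ ?_ ?_ ?_
  · intro x hx y _ hxy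
    exact rpow_le_rpow (by linarith [Set.mem_Ici.1 hx]) hxy (by linarith)
  · filter_upwards [eventually_ge_atTop 0] with x hx
    rw [mul_rpow two_pos.le hx]
    exact mul_le_mul_of_nonneg_right (self_le_rpow_of_one_le one_le_two hα.le) (rpow_nonneg hx _)
  · filter_upwards [eventually_gt_atTop 0,
      (isLittleO_log_rpow_atTop (sub_pos.2 hα)).bound one_pos] with x hx h
    rw [one_mul, norm_eq_abs, norm_eq_abs, abs_of_nonneg (rpow_nonneg hx.le _)] at h
    calc x * log x ≤ x * x ^ (α - 1) := mul_le_mul_of_nonneg_left ((le_abs_self _).trans h) hx.le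
      _ = x ^ α := by
        nth_rewrite 1 [← rpow_one x]
        rw [← rpow_add hx, add_sub_cancel]
  · filter_upwards [eventually_gt_atTop 0,
      (isLittleO_rpow_exp_pos_mul_atTop α (log_pos one_lt_two)).bound one_pos] with x hx h
    rw [one_mul, norm_eq_abs, norm_eq_abs, abs_of_nonneg (exp_pos _).le] at h
    rw [rpow_def_of_pos two_pos]
    exact (le_abs_self _).trans h

theorem mul_log_le_exp_two_mul_log {x : ℝ} (hx : 0 < x) : x * log x ≤ exp (2 * log x) := by
  rw [two_mul, exp_add, exp_log hx]
  exact mul_le_mul_of_nonneg_left (log_le_self hx.le) hx.le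

theorem exists_group_exp_log_rpow {α : ℝ} (hα : 1 < α) :
    ∃ (Γ : Type) (_ : Group Γ), Group.FG Γ ∧ IsLEF Γ ∧
      ∀ S : Set Γ, S.Finite → Subgroup.closure S = ⊤ →
        GrowthEquiv (lefGrowthReal S)
          (fun x => ENNReal.ofReal (exp (exp (log x ^ α)))) := by
  refine exists_group_growthEquiv (f := fun x => exp (log x ^ α)) ?_ ?_ ?_ ?_
  · intro x hx y _ hxy
    have hx' := Set.mem_Ici.1 hx
    exact exp_le_exp.2 (rpow_le_rpow (log_nonneg hx') (log_le_log (by linarith) hxy)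
      (by linarith))
  · filter_upwards [eventually_gt_atTop 0, tendsto_log_atTop.eventually_ge_atTop 1] with x hx h
    have h2 : (0 : ℝ) ≤ log 2 := log_nonneg one_le_two
    have hpos : 0 < log x := by linarith
    -- Writing `y ^ α = y * y ^ (α - 1)`, an increment `log 2` of `y` gains at least `log 2` once
    -- `log x ≥ 1`.
    have key : log x ^ α + log 2 ≤ log (2 * x) ^ α := by
      rw [log_mul two_ne_zero hx.ne']
      have h₁ : ∀ y : ℝ, 0 < y → y ^ α = y * y ^ (α - 1) := fun y hy => by
        nth_rewrite 2 [← rpow_one y]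
        rw [← rpow_add hy, add_sub_cancel]
      have h₂ : (1 : ℝ) ≤ log x ^ (α - 1) := one_le_rpow h (by linarith)
      have h₃ : log x ^ (α - 1) ≤ (log 2 + log x) ^ (α - 1) :=
        rpow_le_rpow hpos.le (by linarith) (by linarith)
      rw [h₁ _ hpos, h₁ (log 2 + log x) (by linarith)]
      nlinarith
    calc 2 * exp (log x ^ α) = exp (log x ^ α + log 2) := by
          rw [exp_add, exp_log two_pos, mul_comm]
      _ ≤ _ := exp_le_exp.2 key
  · filter_upwards [eventually_gt_atTop 0, tendsto_log_atTop.eventually_gt_atTop 0,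
      ((tendsto_rpow_atTop (sub_pos.2 hα)).comp tendsto_log_atTop).eventually_ge_atTop 2]
      with x hx hl h
    refine (mul_log_le_exp_two_mul_log hx).trans (exp_le_exp.2 ?_)
    calc 2 * log x ≤ log x ^ (α - 1) * log x := mul_le_mul_of_nonneg_right h hl.le
      _ = log x ^ α := by
        nth_rewrite 2 [← rpow_one (log x)]
        rw [← rpow_add hl, sub_add_cancel]
  · have hO := (isLittleO_rpow_exp_pos_mul_atTop α one_pos).bound (log_pos one_lt_two)
    filter_upwards [eventually_gt_atTop 0, tendsto_log_atTop.eventually hO] with x hx h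
    rw [one_mul, norm_eq_abs, norm_eq_abs, abs_of_nonneg (exp_pos _).le, exp_log hx] at h
    rw [rpow_def_of_pos two_pos]
    exact exp_le_exp.2 ((le_abs_self _).trans h)

theorem exists_group_exp_rpow {β : ℝ} (hβ₀ : 0 < β) (hβ₁ : β < 1) :
    ∃ (Γ : Type) (_ : Group Γ), Group.FG Γ ∧ IsLEF Γ ∧
      ∀ S : Set Γ, S.Finite → Subgroup.closure S = ⊤ →
        GrowthEquiv (lefGrowthReal S) (fun x => ENNReal.ofReal (exp (exp (x ^ β)))) := by
  refine exists_group_growthEquiv (f := fun x => exp (x ^ β)) ?_ ?_ ?_ ?_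
  · intro x hx y _ hxy
    exact exp_le_exp.2 (rpow_le_rpow (by linarith [Set.mem_Ici.1 hx]) hxy hβ₀.le)
  · have hβ : 0 < (2 : ℝ) ^ β - 1 := sub_pos.2 (one_lt_rpow one_lt_two hβ₀)
    filter_upwards [eventually_gt_atTop 0,
      (tendsto_rpow_atTop hβ₀).eventually_ge_atTop (log 2 / (2 ^ β - 1))] with x hx h
    rw [div_le_iff₀ hβ] at h
    calc 2 * exp (x ^ β) = exp (x ^ β + log 2) := by rw [exp_add, exp_log two_pos, mul_comm]
      _ ≤ exp ((2 * x) ^ β) := by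
        rw [mul_rpow two_pos.le hx.le]
        exact exp_le_exp.2 (by linarith)
  · filter_upwards [eventually_gt_atTop 0,
      (isLittleO_log_rpow_atTop hβ₀).bound (show (0 : ℝ) < 1 / 2 by norm_num)] with x hx h
    rw [norm_eq_abs, norm_eq_abs, abs_of_nonneg (rpow_nonneg hx.le _)] at h
    refine (mul_log_le_exp_two_mul_log hx).trans (exp_le_exp.2 ?_)
    linarith [le_abs_self (log x)]
  · filter_upwards [eventually_gt_atTop 0,
      (tendsto_rpow_atTop (sub_pos.2 hβ₁)).eventually_ge_atTop (log 2)⁻¹] with x hx h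
    rw [rpow_def_of_pos two_pos]
    have h2 : (0 : ℝ) < log 2 := log_pos one_lt_two
    rw [inv_le_iff_one_le_mul₀ h2] at h
    refine exp_le_exp.2 ?_
    calc x ^ β = x ^ β * 1 := (mul_one _).symm
      _ ≤ x ^ β * (x ^ (1 - β) * log 2) := mul_le_mul_of_nonneg_left h (rpow_nonneg hx.le _)
      _ = log 2 * x := by
        rw [← mul_assoc, ← rpow_add hx, add_sub_cancel, rpow_one, mul_comm]

end Functions

end LEFGrowth

theorem corollary1p2 (α β : ℝ) (hα : 1 < α) (hβ₀ : 0 < β) (hβ₁ : β < 1) :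
    ∃ C c : ℝ, 0 < C ∧ 0 < c ∧
      (∃ (Γ₁ : Type) (_ : Group Γ₁), Group.FG Γ₁ ∧ LEFGrowth.IsLEF Γ₁ ∧
        ∀ S : Set Γ₁, S.Finite → Subgroup.closure S = ⊤ →
          LEFGrowth.GrowthEquiv (LEFGrowth.lefGrowthReal S)
            (fun x => ENNReal.ofReal (Real.exp (x ^ α)))) ∧
      (∃ (Γ₂ : Type) (_ : Group Γ₂), Group.FG Γ₂ ∧ LEFGrowth.IsLEF Γ₂ ∧
        ∀ S : Set Γ₂, S.Finite → Subgroup.closure S = ⊤ →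
          LEFGrowth.Preceq
              (fun x => ENNReal.ofReal (Real.exp (c * Real.exp (Real.log x ^ α))))
              (LEFGrowth.lefGrowthReal S) ∧
            LEFGrowth.Preceq (LEFGrowth.lefGrowthReal S)
              (fun x => ENNReal.ofReal (Real.exp (C * Real.exp (Real.log x ^ α))))) ∧
      (∃ (Γ₃ : Type) (_ : Group Γ₃), Group.FG Γ₃ ∧ LEFGrowth.IsLEF Γ₃ ∧
        ∀ S : Set Γ₃, S.Finite → Subgroup.closure S = ⊤ →
          LEFGrowth.Preceq
              (fun x => ENNReal.ofReal (Real.exp (c * Real.exp (x ^ β))))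
              (LEFGrowth.lefGrowthReal S) ∧
            LEFGrowth.Preceq (LEFGrowth.lefGrowthReal S)
              (fun x => ENNReal.ofReal (Real.exp (C * Real.exp (x ^ β))))) := by
  obtain ⟨Γ₁, i₁, fg₁, lef₁, h₁⟩ := LEFGrowth.exists_group_rpow hα
  obtain ⟨Γ₂, i₂, fg₂, lef₂, h₂⟩ := LEFGrowth.exists_group_exp_log_rpow hα
  obtain ⟨Γ₃, i₃, fg₃, lef₃, h₃⟩ := LEFGrowth.exists_group_exp_rpow hβ₀ hβ₁
  -- The groups realise the functions up to equivalence, so both constants can be 1.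
  refine ⟨1, 1, one_pos, one_pos, ⟨Γ₁, i₁, fg₁, lef₁, h₁⟩, ⟨Γ₂, i₂, fg₂, lef₂, fun S hS hS' => ?_⟩,
    ⟨Γ₃, i₃, fg₃, lef₃, fun S hS hS' => ?_⟩⟩
  · simp only [one_mul]
    exact ⟨(h₂ S hS hS').2, (h₂ S hS hS').1⟩
  · simp only [one_mul]
    exact ⟨(h₃ S hS hS').2, (h₃ S hS hS').1⟩
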